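/- Throughout, $A$ is a (not necessarily unital) $C^*$-algebra and "ideal" means closed two-sided ideal. For $X\subseteq A$ put $X^\perp=\{a\in A: ax=xa=0 \text{ for all } x\in X\}$; an ideal $J$ of $A$ is \emph{regular} if $J=J^{\perp\perp}$. A $C^*$-subalgebra $D\subseteq A$ is a \emph{Cartan subalgebra} of $A$ if (1) $D$ contains an approximate unit for $A$; (2) the linear span of the normalizers $\{n\in A: nDn^*\subseteq D \text{ and } n^*Dn\subseteq D\}$ is dense in $A$; (3) there is a faithful conditional expectation $E\colon A\to D$ (a contractive positive linear $D$-bimodule projection of $A$ onto $D$ with $E(a^*a)=0$ only for $a=0$); and (4) $D$ is maximal abelian in $A$. \textbf{Theorem.} If $D$ is a Cartan subalgebra of a $C^*$-algebra $A$ and $J$ is a regular ideal of $A$, then $D/(J\cap D)$, identified with the image of $D$ under the quotient map $A\to A/J$, is a Cartan subalgebra of $A/J$. -/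

import Mathlib

/-- A closed two-sided ideal of a C⋆-algebra. -/
structure CStarIdeal (A : Type*) [NonUnitalCStarAlgebra A] extends Submodule ℂ A where
  mul_mem_left' : ∀ (a : A) {x : A}, x ∈ carrier → a * x ∈ carrier
  mul_mem_right' : ∀ (a : A) {x : A}, x ∈ carrier → x * a ∈ carrier
  isClosed' : IsClosed carrier

namespace CStarIdeal

open Filter Topology

variable {A : Type*} [NonUnitalCStarAlgebra A]

/-- If `u` is the square `b⋆b` of an element of norm at most one, then `1 - u` acts as a
contraction. -/
theorem norm_sub_mul_le (b c : A) (hb : ‖star b * b‖ ≤ 1) :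
    ‖c - c * (star b * b)‖ ≤ ‖c‖ := by
  let := CStarAlgebra.spectralOrder A
  let := CStarAlgebra.spectralOrderedRing A
  have h0 : (0 : A) ≤ star b * b := star_mul_self_nonneg b
  have h1 : ‖(1 : Unitization ℂ A) - ((star b * b : A) : Unitization ℂ A)‖ ≤ 1 := by
    have h2 : (0 : Unitization ℂ A) ≤ ((star b * b : A) : Unitization ℂ A) := by
      rw [Unitization.inr_nonneg_iff]; exact h0
    have h3 : ((star b * b : A) : Unitization ℂ A) ≤ 1 := by
      rw [← CStarAlgebra.norm_le_one_iff_of_nonneg _ h2, Unitization.norm_inr]; exact hb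
    rw [CStarAlgebra.norm_le_one_iff_of_nonneg _ (sub_nonneg.2 h3)]
    exact sub_le_self _ h2
  have h4 : ((c - c * (star b * b) : A) : Unitization ℂ A)
      = (c : Unitization ℂ A) * (1 - ((star b * b : A) : Unitization ℂ A)) := by
    rw [Unitization.inr_sub, Unitization.inr_mul, mul_sub, mul_one]
  rw [← Unitization.norm_inr (𝕜 := ℂ), h4]
  refine (norm_mul_le _ _).trans ?_
  rw [Unitization.norm_inr]
  exact mul_le_of_le_one_right (norm_nonneg _) h1

theorem norm_sq_sub_mul_le (b c : A) (hb : ‖star b * b‖ ≤ 1) :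
    ‖c - c * (star b * b)‖ ^ 2 ≤ ‖star c * c - star c * c * (star b * b)‖ := by
  have h : star (c - c * (star b * b)) * (c - c * (star b * b))
      = star (star (star c * c - star c * c * (star b * b))
        - star (star c * c - star c * c * (star b * b)) * (star b * b)) := by
    simp only [star_sub, star_mul, star_star, sub_mul, mul_sub, mul_assoc]
    abel
  rw [sq, ← CStarRing.norm_star_mul_self, h, norm_star]
  refine (norm_sub_mul_le b _ hb).trans ?_
  rw [norm_star]

/-- The self-adjoint part `J ∩ J⋆` of a closed ideal, as a closed ⋆-subalgebra. -/
def selfAdjointPart (J : CStarIdeal A) : NonUnitalStarSubalgebra ℂ A where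
  carrier := {x | x ∈ J.toSubmodule ∧ star x ∈ J.toSubmodule}
  add_mem' {x y} hx hy := ⟨add_mem hx.1 hy.1, by rw [star_add]; exact add_mem hx.2 hy.2⟩
  zero_mem' := ⟨zero_mem _, by rw [star_zero]; exact zero_mem _⟩
  mul_mem' {x y} hx hy := ⟨J.mul_mem_left' x hy.1, by
    rw [star_mul]; exact J.mul_mem_left' _ hx.2⟩
  smul_mem' c {x} hx := ⟨J.toSubmodule.smul_mem c hx.1, by
    rw [star_smul]; exact J.toSubmodule.smul_mem _ hx.2⟩
  star_mem' {x} hx := ⟨hx.2, by rw [star_star]; exact hx.1⟩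

theorem isClosed_selfAdjointPart (J : CStarIdeal A) :
    IsClosed (J.selfAdjointPart : Set A) :=
  J.isClosed'.inter (J.isClosed'.preimage continuous_star)

theorem exists_approx (J : CStarIdeal A) {y : A} (hy : y ∈ J.selfAdjointPart) {ε : ℝ}
    (hε : 0 < ε) : ∃ b : A, star b * b ∈ J.toSubmodule ∧ ‖star b * b‖ ≤ 1 ∧
      ‖y - y * (star b * b)‖ < ε := by
  have : IsClosed (J.selfAdjointPart : Set A) := J.isClosed_selfAdjointPart
  let : PartialOrder J.selfAdjointPart := CStarAlgebra.spectralOrder J.selfAdjointPart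
  have : StarOrderedRing J.selfAdjointPart := CStarAlgebra.spectralOrderedRing _
  have hl := CStarAlgebra.increasingApproximateUnit J.selfAdjointPart
  have := hl.neBot
  have h1 := (hl.tendsto_mul_left ⟨y, hy⟩).eventually (Metric.ball_mem_nhds _ hε)
  obtain ⟨u, ⟨h1, h2⟩, h3⟩ := ((h1.and hl.eventually_nonneg).and hl.eventually_norm).exists
  obtain ⟨b, rfl⟩ := CStarAlgebra.nonneg_iff_eq_star_mul_self.1 h2
  refine ⟨b, (star b * b).2.1, h3, ?_⟩
  rw [← norm_neg, neg_sub]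
  simpa [dist_eq_norm] using h1

/-- Closed two-sided ideals of C⋆-algebras are self-adjoint. -/
theorem star_mem (J : CStarIdeal A) {x : A} (hx : x ∈ J.toSubmodule) :
    star x ∈ J.toSubmodule := by
  have hy : x * star x ∈ J.selfAdjointPart :=
    ⟨J.mul_mem_right' _ hx, by rw [star_mul, star_star]; exact J.mul_mem_right' _ hx⟩
  have : star x ∈ closure (J.toSubmodule : Set A) := by
    rw [Metric.mem_closure_iff]
    intro ε hε
    obtain ⟨b, hb, hb1, hb2⟩ := J.exists_approx hy (pow_pos hε 2)
    refine ⟨star x * (star b * b), J.mul_mem_left' _ hb, ?_⟩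
    have h := norm_sq_sub_mul_le b (star x) hb1
    rw [star_star] at h
    rw [dist_eq_norm]
    exact lt_of_pow_lt_pow_left₀ 2 hε.le (h.trans_lt hb2)
  have hc : IsClosed (J.toSubmodule : Set A) := J.isClosed'
  rwa [hc.closure_eq] at this

/-- The quotient `A/J` of a C⋆-algebra by a closed two-sided ideal. -/
def Quotient (J : CStarIdeal A) : Type _ := A ⧸ J.toSubmodule

variable (J : CStarIdeal A)

noncomputable instance : NormedAddCommGroup J.Quotient :=
  haveI : IsClosed (J.toSubmodule : Set A) := J.isClosed'
  inferInstanceAs (NormedAddCommGroup (A ⧸ J.toSubmodule))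

noncomputable instance : NormedSpace ℂ J.Quotient :=
  inferInstanceAs (NormedSpace ℂ (A ⧸ J.toSubmodule))

instance : CompleteSpace J.Quotient :=
  inferInstanceAs (CompleteSpace (A ⧸ J.toSubmodule))

/-- The quotient map `A → A/J`, as a linear map. -/
def mkₗ : A →ₗ[ℂ] J.Quotient := J.toSubmodule.mkQ

theorem mkₗ_surjective : Function.Surjective J.mkₗ := J.toSubmodule.mkQ_surjective

theorem mkₗ_eq_iff {x y : A} : J.mkₗ x = J.mkₗ y ↔ x - y ∈ J.toSubmodule :=
  Submodule.Quotient.eq J.toSubmodule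

instance : Mul J.Quotient where
  mul := _root_.Quotient.map₂ (· * ·) (by
    intro a a' ha b b' hb
    replace ha := (Submodule.quotientRel_def _).1 ha
    replace hb := (Submodule.quotientRel_def _).1 hb
    refine (Submodule.quotientRel_def _).2 ?_
    have : a * b - a' * b' = a * (b - b') + (a - a') * b' := by
      rw [mul_sub, sub_mul]; abel
    rw [this]
    exact add_mem (J.mul_mem_left' _ hb) (J.mul_mem_right' _ ha))

instance : Star J.Quotient where
  star := _root_.Quotient.map star (by
    intro a a' ha
    replace ha := (Submodule.quotientRel_def _).1 ha
    refine (Submodule.quotientRel_def _).2 ?_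
    rw [← star_sub]
    exact J.star_mem ha)

theorem mkₗ_mul (x y : A) : J.mkₗ (x * y) = J.mkₗ x * J.mkₗ y := rfl

theorem mkₗ_star (x : A) : J.mkₗ (star x) = star (J.mkₗ x) := rfl

theorem norm_mkₗ_le (x : A) : ‖J.mkₗ x‖ ≤ ‖x‖ :=
  Submodule.Quotient.norm_mk_le J.toSubmodule x

theorem exists_norm_lt (x : J.Quotient) {ε : ℝ} (hε : 0 < ε) :
    ∃ a : A, J.mkₗ a = x ∧ ‖a‖ < ‖x‖ + ε :=
  Submodule.Quotient.norm_mk_lt (S := J.toSubmodule) x hε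

theorem norm_mkₗ_sq_le (a : A) : ‖J.mkₗ a‖ ^ 2 ≤ ‖J.mkₗ (star a * a)‖ := by
  refine le_of_forall_pos_le_add fun ε hε => ?_
  obtain ⟨c, hc, hc'⟩ := J.exists_norm_lt (J.mkₗ (star a * a)) (half_pos hε)
  have hy : star a * a - c ∈ J.toSubmodule := J.mkₗ_eq_iff.1 hc.symm
  obtain ⟨b, hb, hb1, hb2⟩ := J.exists_approx ⟨hy, J.star_mem hy⟩ (half_pos hε)
  have h1 : J.mkₗ a = J.mkₗ (a - a * (star b * b)) := by
    rw [J.mkₗ_eq_iff, sub_sub_cancel]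
    exact J.mul_mem_left' _ hb
  have h2 := (norm_sq_sub_mul_le b a hb1)
  have h3 : star a * a - star a * a * (star b * b)
      = (c - c * (star b * b))
        + ((star a * a - c) - (star a * a - c) * (star b * b)) := by
    rw [sub_mul (star a * a) c]; abel
  have h4 := norm_sub_mul_le b c hb1
  have h5 : ‖J.mkₗ a‖ ^ 2 ≤ ‖a - a * (star b * b)‖ ^ 2 := by
    rw [h1]
    exact pow_le_pow_left₀ (norm_nonneg _) (J.norm_mkₗ_le _) 2
  have h6 := norm_add_le (c - c * (star b * b))
    ((star a * a - c) - (star a * a - c) * (star b * b))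
  rw [← h3] at h6
  linarith

/-- The quotient of a C⋆-algebra by a closed two-sided ideal, with the quotient norm, is a
C⋆-algebra. -/
noncomputable instance : NonUnitalCStarAlgebra J.Quotient where
  __ := (inferInstance : NormedAddCommGroup J.Quotient)
  __ := (inferInstance : NormedSpace ℂ J.Quotient)
  __ := (inferInstance : CompleteSpace J.Quotient)
  mul := (· * ·)
  star := star
  left_distrib := by
    intro x y z
    obtain ⟨x, rfl⟩ := J.mkₗ_surjective x
    obtain ⟨y, rfl⟩ := J.mkₗ_surjective y
    obtain ⟨z, rfl⟩ := J.mkₗ_surjective z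
    simp only [← mkₗ_mul, ← map_add, mul_add]
  right_distrib := by
    intro x y z
    obtain ⟨x, rfl⟩ := J.mkₗ_surjective x
    obtain ⟨y, rfl⟩ := J.mkₗ_surjective y
    obtain ⟨z, rfl⟩ := J.mkₗ_surjective z
    simp only [← mkₗ_mul, ← map_add, add_mul]
  zero_mul := by
    intro x
    obtain ⟨x, rfl⟩ := J.mkₗ_surjective x
    rw [← map_zero J.mkₗ, ← mkₗ_mul, zero_mul]
  mul_zero := by
    intro x
    obtain ⟨x, rfl⟩ := J.mkₗ_surjective x
    rw [← map_zero J.mkₗ, ← mkₗ_mul, mul_zero]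
  mul_assoc := by
    intro x y z
    obtain ⟨x, rfl⟩ := J.mkₗ_surjective x
    obtain ⟨y, rfl⟩ := J.mkₗ_surjective y
    obtain ⟨z, rfl⟩ := J.mkₗ_surjective z
    simp only [← mkₗ_mul, mul_assoc]
  norm_mul_le := by
    intro x y
    refine le_of_forall_gt_imp_ge_of_dense fun r hr => ?_
    have hx : Tendsto (fun ε : ℝ => (‖x‖ + ε) * (‖y‖ + ε)) (𝓝[>] 0) (𝓝 (‖x‖ * ‖y‖)) := by
      have : Continuous (fun ε : ℝ => (‖x‖ + ε) * (‖y‖ + ε)) := by fun_prop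
      simpa using (this.tendsto 0).mono_left nhdsWithin_le_nhds
    obtain ⟨ε, h, hε⟩ := ((hx.eventually (gt_mem_nhds hr)).and self_mem_nhdsWithin).exists
    obtain ⟨a, rfl, ha⟩ := J.exists_norm_lt x hε
    obtain ⟨b, rfl, hb⟩ := J.exists_norm_lt y hε
    rw [← mkₗ_mul]
    refine (J.norm_mkₗ_le _).trans ((norm_mul_le _ _).trans (le_trans ?_ h.le))
    gcongr
  star_involutive := by
    intro x
    obtain ⟨x, rfl⟩ := J.mkₗ_surjective x
    rw [← mkₗ_star, ← mkₗ_star, star_star]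
  star_mul := by
    intro x y
    obtain ⟨x, rfl⟩ := J.mkₗ_surjective x
    obtain ⟨y, rfl⟩ := J.mkₗ_surjective y
    simp only [← mkₗ_star, ← mkₗ_mul, star_mul]
  star_add := by
    intro x y
    obtain ⟨x, rfl⟩ := J.mkₗ_surjective x
    obtain ⟨y, rfl⟩ := J.mkₗ_surjective y
    simp only [← mkₗ_star, ← map_add, star_add]
  norm_mul_self_le := by
    intro x
    obtain ⟨x, rfl⟩ := J.mkₗ_surjective x
    rw [← mkₗ_star, ← mkₗ_mul, ← sq]
    exact J.norm_mkₗ_sq_le x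
  smul_assoc := by
    intro c x y
    obtain ⟨x, rfl⟩ := J.mkₗ_surjective x
    obtain ⟨y, rfl⟩ := J.mkₗ_surjective y
    simp only [smul_eq_mul, ← mkₗ_mul, ← map_smul, smul_mul_assoc]
  smul_comm := by
    intro c x y
    obtain ⟨x, rfl⟩ := J.mkₗ_surjective x
    obtain ⟨y, rfl⟩ := J.mkₗ_surjective y
    simp only [smul_eq_mul, ← mkₗ_mul, ← map_smul, mul_smul_comm]
  star_smul := by
    intro c x
    obtain ⟨x, rfl⟩ := J.mkₗ_surjective x
    simp only [← mkₗ_star, ← map_smul, star_smul]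

/-- The quotient ⋆-homomorphism `A → A/J`. -/
noncomputable def quotientMap : A →⋆ₙₐ[ℂ] J.Quotient where
  toFun := J.mkₗ
  map_smul' := J.mkₗ.map_smul
  map_zero' := J.mkₗ.map_zero
  map_add' := J.mkₗ.map_add
  map_mul' := J.mkₗ_mul
  map_star' := J.mkₗ_star

theorem quotientMap_surjective : Function.Surjective J.quotientMap := J.mkₗ_surjective

theorem quotientMap_eq_zero_iff {x : A} : J.quotientMap x = 0 ↔ x ∈ J.toSubmodule :=
  Submodule.Quotient.mk_eq_zero J.toSubmodule

end CStarIdeal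

/-- The two-sided annihilator `X^⊥ = {a | ax = xa = 0 for all x ∈ X}`. -/
def annihilatorPerp {A : Type*} [NonUnitalCStarAlgebra A] (X : Set A) : Set A :=
  {a | ∀ x ∈ X, a * x = 0 ∧ x * a = 0}

/-- An ideal `J` is regular if `J = J^⊥⊥`. -/
def CStarIdeal.IsRegular {A : Type*} [NonUnitalCStarAlgebra A] (J : CStarIdeal A) : Prop :=
  (J.toSubmodule : Set A) = annihilatorPerp (annihilatorPerp (J.toSubmodule : Set A))

/-- `B ⊆ A` is an inclusion of C⋆-algebras: `B` is a closed ⋆-subalgebra containing an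
approximate unit for `A` (an approximate unit consisting, as usual for C⋆-algebras, of positive
contractions; it is recorded by its filter of tails). -/
structure IsCStarInclusion {A : Type*} [NonUnitalCStarAlgebra A]
    (B : NonUnitalStarSubalgebra ℂ A) : Prop where
  isClosed : IsClosed (B : Set A)
  exists_approximateUnit : ∃ l : Filter A, l.IsApproximateUnit ∧
    ∀ᶠ u in l, u ∈ B ∧ ‖u‖ ≤ 1 ∧ ∃ b ∈ B, u = star b * b

/-- The normalizers of `B` in `A`. -/
def cstarNormalizers {A : Type*} [NonUnitalCStarAlgebra A]
    (B : NonUnitalStarSubalgebra ℂ A) : Set A :=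
  {n | ∀ b ∈ B, n * b * star n ∈ B ∧ star n * b * n ∈ B}

/-- A regular inclusion: the normalizers of `B` have dense linear span in `A`. -/
structure IsRegularInclusion {A : Type*} [NonUnitalCStarAlgebra A]
    (B : NonUnitalStarSubalgebra ℂ A) : Prop extends IsCStarInclusion B where
  dense_span : Dense (Submodule.span ℂ (cstarNormalizers B) : Set A)

/-- A conditional expectation of `A` onto `B`: a contractive positive linear projection of `A`
onto `B` that is a `B`-bimodule map. -/
structure IsConditionalExpectation {A : Type*} [NonUnitalCStarAlgebra A]
    (B : NonUnitalStarSubalgebra ℂ A) (E : A →ₗ[ℂ] B) : Prop where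
  map_coe : ∀ b : B, E (b : A) = b
  map_mul_left : ∀ (b : B) (a : A), E ((b : A) * a) = b * E a
  map_mul_right : ∀ (a : A) (b : B), E (a * (b : A)) = E a * b
  map_nonneg : ∀ a : A, ∃ b : B, E (star a * a) = star b * b
  norm_le : ∀ a : A, ‖E a‖ ≤ ‖a‖

/-- `D` is maximal abelian in `A`: it is commutative, and no commutative ⋆-subalgebra of `A`
properly contains it. -/
def IsMaximalAbelian {A : Type*} [NonUnitalCStarAlgebra A]
    (D : NonUnitalStarSubalgebra ℂ A) : Prop :=
  Maximal (fun C : NonUnitalStarSubalgebra ℂ A => ∀ x ∈ C, ∀ y ∈ C, x * y = y * x) D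

/-- `D` is a Cartan subalgebra of `A`. -/
structure IsCartanSubalgebra {A : Type*} [NonUnitalCStarAlgebra A]
    (D : NonUnitalStarSubalgebra ℂ A) : Prop extends IsRegularInclusion D where
  exists_faithful_expectation : ∃ E : A →ₗ[ℂ] D, IsConditionalExpectation D E ∧
    ∀ a : A, E (star a * a) = 0 → a = 0
  isMaximalAbelian : IsMaximalAbelian D

/-!
Let `E` be the faithful expectation of `A` onto `D`, and write `K = J^⊥`.

The core of the argument is that a regular ideal `J` is the annihilator of `D ∩ K`
(`IsCartanSubalgebra.mem_ideal_iff`). Granting this, `E a * h = E (a * h) = 0` for `a ∈ J` and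
`h ∈ D ∩ K`, so `E` maps `J` into `J` and induces an expectation of `A/J` onto the image of `D`.
This image is closed, being the fixed point set of the induced map. If `E (a⋆a) ∈ J`, then
`E ((ah)⋆(ah)) = h⋆ E (a⋆a) h = 0` for all `h ∈ D ∩ K`, so `a h = 0` by faithfulness and `a ∈ J`: the
induced expectation is faithful. The approximate unit and the density of the normalizers pass to
the quotient directly.

The description of `J` rests on the fact that `D` detects ideals
(`IsCartanSubalgebra.eq_zero_of_mem_ideal`). A normalizer `n` is the sum of `E n` and a normalizer of
expectation zero (`sub_expectation_mem`), and the latter acts freely: below any nonzero element of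
`D` some nonzero `c ∈ D` compresses it to zero (`exists_compression_eq_zero`). This is where
maximality of `D` enters: a normalizer which is local, in that `c₁ x c₂ = 0` whenever `c₁ c₂ = 0` in
`D`, acts as the identity on the spectrum of `D` (`eq_mul_of_mul_eq_zero`, by Gelfand duality), so it
commutes with `D` and lies in `D`. Compressing an approximation of `z = a⋆a` therefore brings `c z c`
close to `c (E z) c`, whose norm is comparable to `‖E z‖ ‖c‖²`; if `z` lies in an ideal `L` with
`D ∩ L = 0`, then `D` embeds isometrically into `A/L`, a contradiction unless `E z = 0`.

Finally, the image of `D` is maximal abelian because an element of `A/J` which commutes with it and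
has expectation zero vanishes (`mem_ideal_of_comm`). The proof moves the commutation relations back
to `A` by multiplying them with elements of `D ∩ K`.
-/

open Filter Topology WeakDual

/-! ### The Gelfand transform of a commutative C⋆-algebra -/

section Gelfand

variable (B : Type*) [NonUnitalCommCStarAlgebra B]

/-- The Gelfand transform of a commutative, not necessarily unital, C⋆-algebra `B`, with values in
the continuous functions on the character space of the unitization of `B`. Besides the
spectrum of `B`, that space has one further point, at which all these functions vanish. -/
noncomputable def gelfandInr :
    B →⋆ₙₐ[ℂ] C(characterSpace ℂ (Unitization ℂ B), ℂ) :=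
  ((gelfandStarTransform (Unitization ℂ B) :
    Unitization ℂ B →⋆ₐ[ℂ] C(characterSpace ℂ (Unitization ℂ B), ℂ)) :
    Unitization ℂ B →⋆ₙₐ[ℂ] C(characterSpace ℂ (Unitization ℂ B), ℂ)).comp
    (Unitization.inrNonUnitalStarAlgHom ℂ B)

variable {B}

theorem gelfandInr_eq (b : B) :
    gelfandInr B b = gelfandStarTransform (Unitization ℂ B) (b : Unitization ℂ B) := rfl

theorem gelfandInr_apply (b : B) (x : characterSpace ℂ (Unitization ℂ B)) :
    gelfandInr B b x = x (b : Unitization ℂ B) := rfl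

theorem norm_gelfandInr (b : B) : ‖gelfandInr B b‖ = ‖b‖ := by
  rw [gelfandInr_eq, ← Unitization.norm_inr (𝕜 := ℂ) b]
  exact (gelfandTransform_isometry (Unitization ℂ B)).norm_map_of_map_zero (map_zero _) _

theorem gelfandInr_injective : Function.Injective (gelfandInr B) := by
  rw [injective_iff_map_eq_zero]
  intro b hb
  rw [← norm_eq_zero, ← norm_gelfandInr, hb, norm_zero]

/-- The image of the Gelfand transform is an ideal in the algebra of continuous functions. -/
theorem exists_gelfandInr_eq_mul (b : B) (F : C(characterSpace ℂ (Unitization ℂ B), ℂ)) :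
    ∃ c : B, gelfandInr B c = gelfandInr B b * F := by
  obtain ⟨f, rfl⟩ : ∃ f, gelfandStarTransform (Unitization ℂ B) f = F :=
    (gelfandStarTransform (Unitization ℂ B)).surjective F
  refine ⟨((b : Unitization ℂ B) * f).snd, ?_⟩
  rw [gelfandInr_eq, gelfandInr_eq, ← map_mul]
  congr 1
  ext <;> simp

theorem exists_gelfandInr_eq_apply (φ : B →ₙₐ[ℂ] ℂ) :
    ∃ x : characterSpace ℂ (Unitization ℂ B), ∀ b, gelfandInr B b x = φ b :=
  ⟨CharacterSpace.equivAlgHom.symm (Unitization.lift φ), fun b => by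
    rw [gelfandInr_apply]
    change Unitization.lift φ (b : Unitization ℂ B) = φ b
    simp⟩

theorem exists_norm_gelfandInr_apply_eq (b : B) : ∃ x, ‖gelfandInr B b x‖ = ‖b‖ := by
  obtain ⟨x, -, hx⟩ := isCompact_univ.exists_isMaxOn Set.univ_nonempty
    (gelfandInr B b).continuous.norm.continuousOn
  refine ⟨x, le_antisymm ?_ ?_⟩
  · exact norm_gelfandInr b ▸ ContinuousMap.norm_coe_le_norm _ x
  · exact norm_gelfandInr b ▸ (ContinuousMap.norm_le _ (norm_nonneg _)).2 fun y => hx trivial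

/-- For nonzero `h` there is a nonzero `d`, supported where `h` has modulus at least `‖h‖ / 2`. -/
theorem exists_norm_mul_mul_ge {h : B} (hh : h ≠ 0) :
    ∃ d : B, d ≠ 0 ∧ ∀ b : B, ‖h‖ / 2 * ‖d * b‖ ^ 2 ≤ ‖d * b * h * (d * b)‖ := by
  obtain ⟨x₀, hx₀⟩ := exists_norm_gelfandInr_apply_eq h
  have hpos : 0 < ‖h‖ := norm_pos_iff.2 hh
  let F : C(characterSpace ℂ (Unitization ℂ B), ℂ) :=
    ⟨fun x => ((max 0 (‖gelfandInr B h x‖ - ‖h‖ / 2) : ℝ) : ℂ), by fun_prop⟩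
  obtain ⟨d, hd⟩ := exists_gelfandInr_eq_mul h F
  refine ⟨d, ?_, fun b => ?_⟩
  · rintro rfl
    have h1 := congrArg (fun f => ‖f x₀‖) hd
    simp only [map_zero, ContinuousMap.mul_apply, norm_mul, hx₀, F, ContinuousMap.coe_mk,
      ContinuousMap.zero_apply, norm_zero] at h1
    rw [max_eq_right (by linarith)] at h1
    have h2 : ‖((‖h‖ - ‖h‖ / 2 : ℝ) : ℂ)‖ = ‖h‖ / 2 := by
      rw [Complex.norm_real, Real.norm_eq_abs, abs_of_nonneg (by linarith)]; ring
    rw [h2] at h1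
    nlinarith
  · obtain ⟨x, hx⟩ := exists_norm_gelfandInr_apply_eq (d * b)
    rw [← hx, ← norm_gelfandInr (d * b * h * (d * b))]
    refine le_trans ?_ (ContinuousMap.norm_coe_le_norm _ x)
    simp only [map_mul, hd, ContinuousMap.mul_apply, norm_mul]
    rcases le_or_gt (‖h‖ / 2) ‖gelfandInr B h x‖ with h1 | h1
    · calc _ ≤ ‖gelfandInr B h x‖ * (‖gelfandInr B h x‖ * ‖F x‖ * ‖gelfandInr B b x‖) ^ 2 := by
            gcongr
        _ = _ := by ring
    · have : F x = 0 := by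
        simp only [F, ContinuousMap.coe_mk]
        rw [max_eq_left (by linarith), Complex.ofReal_zero]
      simp [this]

/-- A weighted homomorphism `θ` of a commutative C⋆-algebra, of weight `p`, which does not increase
supports is multiplication by `p`. Where `p` does not vanish, `θ` divided by `p` is composition
with a partial map of the spectrum; the hypothesis on supports forces that map to be the
identity. -/
theorem eq_mul_of_mul_eq_zero (θ : B →ₗ[ℂ] B) {p k : B} (hθ : ∀ a b, θ a * θ b = p * θ (a * b))
    (hk : θ k = p * p) (hs : ∀ a b, a * b = 0 → a * θ b = 0) (g : B) : θ g = g * p := by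
  apply gelfandInr_injective
  ext x
  rw [map_mul, ContinuousMap.mul_apply]
  have hθ' (a b : B) : gelfandInr B (θ a) x * gelfandInr B (θ b) x
      = gelfandInr B p x * gelfandInr B (θ (a * b)) x := by
    simpa using congrArg (fun c => gelfandInr B c x) (hθ a b)
  by_cases hp : gelfandInr B p x = 0
  · have := hθ' g g
    rw [hp, zero_mul, mul_self_eq_zero] at this
    rw [this, hp, mul_zero]
  let φ : B →ₙₐ[ℂ] ℂ :=
    { toFun := fun b => gelfandInr B (θ b) x / gelfandInr B p x
      map_smul' := fun c b => by simp [mul_div_assoc]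
      map_zero' := by simp
      map_add' := fun b c => by simp [add_div]
      map_mul' := fun b c => by
        rw [div_mul_div_comm, hθ', mul_div_mul_left _ _ hp] }
  obtain ⟨y, hy⟩ := exists_gelfandInr_eq_apply φ
  by_cases hxy : x = y
  · subst hxy
    have h1 : gelfandInr B g x * gelfandInr B p x = gelfandInr B (θ g) x := by
      rw [hy]
      exact div_mul_cancel₀ _ hp
    exact h1.symm
  -- Otherwise disjoint neighbourhoods of `x` and `y` separate an element from its image.
  obtain ⟨U, V, hU, hV, hxU, hyV, hUV⟩ := t2_separation hxy
  obtain ⟨f, hf0, hf1, -⟩ := exists_continuous_zero_one_of_isClosed hU.isClosed_compl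
    (isClosed_singleton (x := x)) (by simpa using hxU)
  obtain ⟨f', hf0', hf1', -⟩ := exists_continuous_zero_one_of_isClosed hV.isClosed_compl
    (isClosed_singleton (x := y)) (by simpa using hyV)
  obtain ⟨a, ha⟩ := exists_gelfandInr_eq_mul p ⟨fun z => (f z : ℂ), by fun_prop⟩
  obtain ⟨b, hb⟩ := exists_gelfandInr_eq_mul k ⟨fun z => (f' z : ℂ), by fun_prop⟩
  have hab : a * b = 0 := by
    apply gelfandInr_injective
    ext z
    rw [map_mul, ha, hb, map_zero]
    by_cases hz : z ∈ U
    · have : f' z = 0 := hf0' (fun h => Set.disjoint_left.1 hUV hz h)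
      simp [this]
    · have : f z = 0 := hf0 hz
      simp [this]
  exfalso
  have h1 : gelfandInr B a x * gelfandInr B (θ b) x = 0 := by
    simpa using congrArg (fun c => gelfandInr B c x) (hs a b hab)
  have h2 : f x = 1 := hf1 rfl
  have h3 : f' y = 1 := hf1' rfl
  have h4 : gelfandInr B (θ b) x = gelfandInr B k y * gelfandInr B p x := by
    have h5 : gelfandInr B b y = gelfandInr B k y := by
      rw [hb]; simp [h3]
    rw [← h5, hy]
    exact (div_mul_cancel₀ _ hp).symm
  have h6 : gelfandInr B k y = gelfandInr B p x := by
    rw [hy]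
    change gelfandInr B (θ k) x / gelfandInr B p x = _
    rw [hk, map_mul, ContinuousMap.mul_apply, mul_div_cancel_right₀ _ hp]
  rw [h4, h6, ha] at h1
  simp [h2, hp] at h1

end Gelfand

/-! ### Normalizers and expectations -/

section Normalizers

variable {A : Type*} [NonUnitalCStarAlgebra A] {D : NonUnitalStarSubalgebra ℂ A}

theorem star_mem_cstarNormalizers {n : A} (hn : n ∈ cstarNormalizers D) :
    star n ∈ cstarNormalizers D := fun b hb => by
  rw [star_star]
  exact (hn b hb).symm

theorem mem_cstarNormalizers_of_mem {d : A} (hd : d ∈ D) : d ∈ cstarNormalizers D :=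
  fun _ hb => ⟨mul_mem (mul_mem hd hb) (star_mem hd), mul_mem (mul_mem (star_mem hd) hb) hd⟩

theorem mul_mem_cstarNormalizers {m n : A} (hm : m ∈ cstarNormalizers D)
    (hn : n ∈ cstarNormalizers D) : m * n ∈ cstarNormalizers D := fun b hb => by
  have h1 := (hm _ (hn b hb).1).1
  have h2 := (hn _ (hm b hb).2).2
  simp only [star_mul, mul_assoc] at h1 h2 ⊢
  exact ⟨h1, h2⟩

namespace IsCStarInclusion

theorem star_mul_self_mem (hD : IsCStarInclusion D) {n : A} (hn : n ∈ cstarNormalizers D) :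
    star n * n ∈ D := by
  obtain ⟨l, hl, hlD⟩ := hD.exists_approximateUnit
  have := hl.neBot
  have h : Tendsto (fun u => star n * (u * n)) l (𝓝 (star n * n)) :=
    (hl.tendsto_mul_right n).const_mul _
  refine hD.isClosed.mem_of_tendsto h (hlD.mono fun u hu => ?_)
  rw [← mul_assoc]
  exact (hn u hu.1).2

theorem mul_star_self_mem (hD : IsCStarInclusion D) {n : A} (hn : n ∈ cstarNormalizers D) :
    n * star n ∈ D := by
  have := hD.star_mul_self_mem (star_mem_cstarNormalizers hn)
  rwa [star_star] at this

end IsCStarInclusion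

namespace IsCartanSubalgebra

variable (hD : IsCartanSubalgebra D)
include hD

theorem comm {x y : A} (hx : x ∈ D) (hy : y ∈ D) : x * y = y * x :=
  hD.isMaximalAbelian.prop x hx y hy

/-- A Cartan subalgebra is itself a commutative C⋆-algebra. -/
noncomputable abbrev nonUnitalCommCStarAlgebra : NonUnitalCommCStarAlgebra D :=
  haveI : IsClosed (D : Set A) := hD.isClosed
  letI : NonUnitalCommRing D := { mul_comm := fun a b => Subtype.ext (hD.comm a.2 b.2) }
  { }

theorem mem_of_isSelfAdjoint {x : A} (hx : IsSelfAdjoint x) (h : ∀ d ∈ D, x * d = d * x) :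
    x ∈ D := by
  have hc : IsMulCommutative (NonUnitalStarAlgebra.adjoin ℂ (insert x (D : Set A))) := by
    refine NonUnitalStarAlgebra.isMulCommutative_adjoin ℂ ?_ ?_
    · rintro a (rfl | ha) b (rfl | hb)
      · rfl
      · exact h b hb
      · exact (h a ha).symm
      · exact hD.comm ha hb
    · rintro a (rfl | ha) b (rfl | hb)
      · rw [hx.star_eq]
      · exact h _ (star_mem hb)
      · rw [hx.star_eq]
        exact (h a ha).symm
      · exact hD.comm ha (star_mem hb)
  refine hD.isMaximalAbelian.le_of_ge (y := NonUnitalStarAlgebra.adjoin ℂ (insert x (D : Set A)))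
    (fun a ha b hb => ?_) (fun d hd => ?_) ?_
  · exact congrArg Subtype.val (hc.is_comm.comm (⟨a, ha⟩ : NonUnitalStarAlgebra.adjoin ℂ _) ⟨b, hb⟩)
  · exact NonUnitalStarAlgebra.subset_adjoin ℂ _ (Set.mem_insert_of_mem _ hd)
  · exact NonUnitalStarAlgebra.subset_adjoin ℂ _ (Set.mem_insert _ _)

/-- A Cartan subalgebra equals its relative commutant. -/
theorem mem_of_forall_comm {x : A} (h : ∀ d ∈ D, x * d = d * x) : x ∈ D := by
  have h' : ∀ d ∈ D, star x * d = d * star x := fun d hd => by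
    simpa using (congrArg star (h (star d) (star_mem hd))).symm
  have h1 : x + star x ∈ D := hD.mem_of_isSelfAdjoint (.add_star_self x) fun d hd => by
    rw [add_mul, mul_add, h d hd, h' d hd]
  have h2 : Complex.I • (x - star x) ∈ D := by
    refine hD.mem_of_isSelfAdjoint ?_ fun d hd => ?_
    · rw [IsSelfAdjoint, star_smul, star_sub, star_star, ← neg_sub x (star x), smul_neg, ← neg_smul]
      simp
    · rw [smul_mul_assoc, mul_smul_comm, sub_mul, mul_sub, h d hd, h' d hd]
  have h3 : x = (1 / 2 : ℂ) • ((x + star x) - Complex.I • (Complex.I • (x - star x))) := by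
    rw [smul_smul, Complex.I_mul_I, neg_one_smul, sub_neg_eq_add, add_add_sub_cancel, ← two_smul ℂ x,
      smul_smul]
    norm_num
  rw [h3]
  exact SMulMemClass.smul_mem _ (sub_mem h1 (SMulMemClass.smul_mem _ h2))

/-- The left annihilator of `star n` is stable under right multiplication by `D`. -/
theorem mul_mul_star_eq_zero {n z d : A} (hn : n ∈ cstarNormalizers D) (hd : d ∈ D)
    (hz : z * star n = 0) : z * d * star n = 0 := by
  rw [← CStarRing.mul_star_self_eq_zero_iff]
  have h1 := hD.comm hd (hD.star_mul_self_mem hn)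
  calc z * d * star n * star (z * d * star n)
      = z * (d * (star n * n)) * star d * star z := by
        simp only [star_mul, star_star, mul_assoc]
    _ = z * star n * n * d * star d * star z := by
        rw [h1]; simp only [mul_assoc]
    _ = 0 := by rw [hz]; simp only [zero_mul]

/-- A normalizer which implements the identity on `D` commutes with `D`, hence lies in `D`. -/
theorem mem_of_forall_mul_mul_star_eq {x : A} (hx : x ∈ cstarNormalizers D)
    (h : ∀ d ∈ D, x * d * star x = d * (x * star x)) : x ∈ D := by
  refine hD.mem_of_forall_comm fun d hd => ?_
  rw [← sub_eq_zero, ← CStarRing.mul_star_self_eq_zero_iff]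
  have h1 : (x * d - d * x) * star x = 0 := by
    rw [sub_mul, h d hd, mul_assoc, sub_self]
  have h2 := hD.mul_mul_star_eq_zero hx (star_mem hd) h1
  rw [star_sub, star_mul, star_mul, mul_sub, ← mul_assoc, ← mul_assoc, h2, h1, zero_mul, sub_zero]

/-- A normalizer outside `D` connects two elements of `D` with disjoint supports. On the spectrum of
`D` a normalizer acts by a partial map, and it lies in `D` exactly when that map is the identity. -/
theorem exists_mul_eq_zero {x : A} (hx : x ∈ cstarNormalizers D) (hxD : x ∉ D) :
    ∃ c₁ ∈ D, ∃ c₂ ∈ D, c₁ * c₂ = 0 ∧ c₁ * x * c₂ ≠ 0 := by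
  by_contra! hc
  refine hxD (hD.mem_of_forall_mul_mul_star_eq hx fun g hg => ?_)
  let := hD.nonUnitalCommCStarAlgebra
  let θ : D →ₗ[ℂ] D :=
    { toFun := fun d => ⟨x * d * star x, (hx d d.2).1⟩
      map_add' := fun a b => Subtype.ext (by simp [mul_add, add_mul])
      map_smul' := fun c a => Subtype.ext (by simp [mul_smul_comm, smul_mul_assoc]) }
  have hp := hD.mul_star_self_mem hx
  have hk := hD.star_mul_self_mem hx
  refine congrArg Subtype.val (eq_mul_of_mul_eq_zero θ (p := ⟨x * star x, hp⟩)
    (k := ⟨star x * x, hk⟩) (fun a b => Subtype.ext ?_) (Subtype.ext ?_)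
    (fun a b hab => Subtype.ext ?_) ⟨g, hg⟩)
  · change x * a * star x * (x * b * star x) = x * star x * (x * (a * b) * star x)
    calc x * a * star x * (x * b * star x) = x * (a * (star x * x)) * b * star x := by
          simp only [mul_assoc]
      _ = _ := by rw [hD.comm a.2 hk]; simp only [mul_assoc]
  · change x * (star x * x) * star x = x * star x * (x * star x)
    simp only [mul_assoc]
  · change (a : A) * (x * b * star x) = 0
    rw [← mul_assoc, ← mul_assoc, hc a a.2 b b.2 (congrArg Subtype.val hab), zero_mul]

end IsCartanSubalgebra

namespace IsConditionalExpectation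

variable {E : A →ₗ[ℂ] D} (hE : IsConditionalExpectation D E)
include hE

theorem map_of_mem {d : A} (hd : d ∈ D) : (E d : A) = d := congrArg Subtype.val (hE.map_coe ⟨d, hd⟩)

theorem mul_left {d : A} (hd : d ∈ D) (a : A) : (E (d * a) : A) = d * E a :=
  congrArg Subtype.val (hE.map_mul_left ⟨d, hd⟩ a)

theorem mul_right (a : A) {d : A} (hd : d ∈ D) : (E (a * d) : A) = E a * d :=
  congrArg Subtype.val (hE.map_mul_right a ⟨d, hd⟩)

theorem map_sub_map (a : A) : E (a - E a) = 0 := by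
  rw [map_sub, hE.map_coe, sub_self]

theorem continuous : Continuous fun a => (E a : A) :=
  continuous_subtype_val.comp
    (E.mkContinuous 1 fun a => by rw [one_mul]; exact hE.norm_le a).continuous

/-- A conditional expectation preserves adjoints, since it preserves positivity and the positive
elements span. -/
theorem map_star (a : A) : (E (star a) : A) = star (E a : A) := by
  let := CStarAlgebra.spectralOrder A
  let := CStarAlgebra.spectralOrderedRing A
  have ha : a ∈ Submodule.span ℂ {a : A | 0 ≤ a} := by
    rw [CStarAlgebra.span_nonneg]; trivial
  induction ha using Submodule.span_induction with
  | mem a ha =>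
    obtain ⟨b, rfl⟩ := CStarAlgebra.nonneg_iff_eq_star_mul_self.1 (show 0 ≤ a from ha)
    obtain ⟨c, hc⟩ := hE.map_nonneg b
    rw [star_mul, star_star, hc]
    simp
  | zero => simp
  | add a b _ _ ha hb => simp [ha, hb]
  | smul c a _ ha => simp [ha]

end IsConditionalExpectation

end Normalizers

/-! ### Freeness of normalizers of expectation zero -/

section FreeNormalizers

variable {A : Type*} [NonUnitalCStarAlgebra A] {D : NonUnitalStarSubalgebra ℂ A}

namespace IsCartanSubalgebra

variable (hD : IsCartanSubalgebra D) {E : A →ₗ[ℂ] D} (hE : IsConditionalExpectation D E)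
include hD hE

/-- A normalizer `n` coincides with `E n` on the support of `E n`: the element `(E n)⋆ n` commutes
with `D`, so it lies in `D` and is its own expectation. -/
theorem star_expectation_mul {n : A} (hn : n ∈ cstarNormalizers D) :
    star (E n : A) * n = star (E n : A) * E n := by
  set e : A := ↑(E n) with he
  have heD : e ∈ D := (E n).2
  have hp := hD.star_mul_self_mem hn
  have hq := hD.mul_star_self_mem hn
  have h1 : ∀ d ∈ D, n * d * star n * e = e * (star n * n) * d := fun d hd => by
    have h2 := hE.mul_left (hn d hd).1 n
    have h3 : n * d * star n * n = n * (star n * n * d) := by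
      rw [← hD.comm hd hp]; simp only [mul_assoc]
    rw [h3, hE.mul_right n (mul_mem hp hd)] at h2
    rw [← h2, ← mul_assoc]
  have h0 : n * star n * e = e * (star n * n) := by
    have h2 := hE.mul_left hq n
    have h3 : n * star n * n = n * (star n * n) := mul_assoc _ _ _
    rw [h3, hE.mul_right n hp] at h2
    exact h2.symm
  have h4 : star e * n ∈ D := by
    refine hD.mem_of_forall_mul_mul_star_eq
      (mul_mem_cstarNormalizers (mem_cstarNormalizers_of_mem (star_mem heD)) hn) fun d hd => ?_
    calc star e * n * d * star (star e * n) = star e * (n * d * star n * e) := by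
          simp only [star_mul, star_star, mul_assoc]
      _ = star e * (e * (star n * n)) * d := by rw [h1 d hd]; simp only [mul_assoc]
      _ = d * (star e * (n * star n * e)) := by
          rw [h0, hD.comm hd (mul_mem (star_mem heD) (mul_mem heD hp))]
      _ = d * (star e * n * star (star e * n)) := by
          simp only [star_mul, star_star, mul_assoc]
  rw [← hE.map_of_mem h4, hE.mul_left (star_mem heD)]

theorem mul_star_expectation {n : A} (hn : n ∈ cstarNormalizers D) :
    n * star (E n : A) = E n * star (E n : A) := by
  have h := congrArg star (hD.star_expectation_mul hE (star_mem_cstarNormalizers hn))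
  rw [hE.map_star] at h
  simpa using h

/-- Removing its expectation from a normalizer leaves a normalizer. -/
theorem sub_expectation_mem {n : A} (hn : n ∈ cstarNormalizers D) :
    n - E n ∈ cstarNormalizers D := fun d hd => by
  set e : A := ↑(E n) with he
  have heD : e ∈ D := (E n).2
  have h1 := hD.star_expectation_mul hE hn
  have h2 := hD.mul_star_expectation hE hn
  rw [← he] at h1 h2
  have h1' : star n * e = star e * e := by simpa using congrArg star h1
  have h2' : e * star n = e * star e := by simpa using congrArg star h2
  constructor
  · have h3 : (n - e) * d * star (n - e) = n * d * star n - e * d * star e := by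
      have h4 : n * d * star e = e * d * star e := by
        rw [mul_assoc, hD.comm hd (star_mem heD), ← mul_assoc, h2, mul_assoc,
          hD.comm (star_mem heD) hd, ← mul_assoc]
      have h5 : e * d * star n = e * d * star e := by
        rw [hD.comm heD hd, mul_assoc, mul_assoc, h2']
      rw [star_sub, mul_sub, sub_mul, sub_mul, sub_mul, h4, h5]
      abel
    rw [h3]
    exact sub_mem (hn d hd).1 (mul_mem (mul_mem heD hd) (star_mem heD))
  · have h3 : star (n - e) * d * (n - e) = star n * d * n - star e * d * e := by
      have h4 : star n * d * e = star e * d * e := by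
        rw [mul_assoc, hD.comm hd heD, ← mul_assoc, h1', mul_assoc, hD.comm heD hd, ← mul_assoc]
      have h5 : star e * d * n = star e * d * e := by
        rw [hD.comm (star_mem heD) hd, mul_assoc, mul_assoc, h1]
      rw [star_sub, mul_sub, sub_mul, sub_mul, sub_mul, h4, h5]
      abel
    rw [h3]
    exact sub_mem (hn d hd).2 (mul_mem (mul_mem (star_mem heD) hd) heD)

/-- Modulo `D`, a combination of normalizers is a combination of normalizers of expectation
zero. -/
theorem sub_expectation_mem_span {b : A} (hb : b ∈ Submodule.span ℂ (cstarNormalizers D)) :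
    b - E b ∈ Submodule.span ℂ {m | m ∈ cstarNormalizers D ∧ E m = 0} := by
  induction hb using Submodule.span_induction with
  | mem n hn =>
    exact Submodule.subset_span
      ⟨hD.sub_expectation_mem hE hn, hE.map_sub_map n⟩
  | zero => simp
  | add a b _ _ ha hb =>
    have := add_mem ha hb
    rw [sub_add_sub_comm] at this
    simpa using this
  | smul c a _ ha =>
    have := Submodule.smul_mem _ c ha
    rw [smul_sub] at this
    simpa using this

/-- A normalizer of expectation zero acts freely: below any nonzero element of `D` there is a
nonzero one that compresses the normalizer to zero. -/
theorem exists_compression_eq_zero_of_mem {m : A} (hm : m ∈ cstarNormalizers D) (hm0 : E m = 0)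
    {d : A} (hd : d ∈ D) (hd0 : d ≠ 0) :
    ∃ b ∈ D, d * b ≠ 0 ∧ d * b * m * (d * b) = 0 := by
  by_cases hx0 : d * m * d = 0
  · refine ⟨star d, star_mem hd, fun h => hd0 (CStarRing.mul_star_self_eq_zero_iff _ |>.1 h), ?_⟩
    calc d * star d * m * (d * star d) = star d * (d * m * d) * star d := by
          nth_rewrite 1 [hD.comm hd (star_mem hd)]; simp only [mul_assoc]
      _ = 0 := by rw [hx0, mul_zero, zero_mul]
  have hxN : d * m * d ∈ cstarNormalizers D :=
    mul_mem_cstarNormalizers (mul_mem_cstarNormalizers (mem_cstarNormalizers_of_mem hd) hm)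
      (mem_cstarNormalizers_of_mem hd)
  have hxD : d * m * d ∉ D := fun h => hx0 <| by
    rw [← hE.map_of_mem h, hE.mul_right _ hd, hE.mul_left hd, hm0]
    simp
  obtain ⟨c₁, hc₁, c₂, hc₂, hc, hne⟩ := hD.exists_mul_eq_zero hxN hxD
  set C : A := star d * (star c₁ * c₁) * d with hC
  have hCD : C ∈ D := mul_mem (mul_mem (star_mem hd) (mul_mem (star_mem hc₁) hc₁)) hd
  set w : A := star m * C * m with hw
  have hwD : w ∈ D := (hm C hCD).2
  set e : A := c₂ * (star c₂ * star d) with he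
  have heD : e ∈ D := mul_mem hc₂ (mul_mem (star_mem hc₂) (star_mem hd))
  have heC : e * C = 0 := by
    have hd2 : star d * star d ∈ D := mul_mem (star_mem hd) (star_mem hd)
    calc e * C = c₂ * (star c₂ * (star d * star d * star c₁)) * c₁ * d := by
          rw [he, hC]; simp only [mul_assoc]
      _ = c₂ * (star (c₁ * c₂) * (star d * star d)) * c₁ * d := by
          rw [hD.comm hd2 (star_mem hc₁), star_mul]; simp only [mul_assoc]
      _ = 0 := by rw [hc]; simp only [star_zero, zero_mul, mul_zero]
  -- This makes `d * (e * w)` nonzero.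
  have hcw : star (c₁ * (d * m * d) * c₂) * (c₁ * (d * m * d) * c₂) = d * (e * w) := by
    calc star (c₁ * (d * m * d) * c₂) * (c₁ * (d * m * d) * c₂)
        = star c₂ * star d * w * (d * c₂) := by
          rw [hw, hC]; simp only [star_mul, mul_assoc]
      _ = d * c₂ * (star c₂ * star d * w) :=
          hD.comm (mul_mem (mul_mem (star_mem hc₂) (star_mem hd)) hwD) (mul_mem hd hc₂)
      _ = d * (e * w) := by rw [he]; simp only [mul_assoc]
  refine ⟨e * w, mul_mem heD hwD, ?_, ?_⟩
  · rw [← hcw]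
    exact fun h => hne ((CStarRing.star_mul_self_eq_zero_iff _).1 h)
  · set f : A := d * e with hf
    have hfD : f ∈ D := mul_mem hd heD
    rw [← mul_assoc d e w, ← hf]
    -- `m f m⋆` lies in `D`, hence commutes with `f`.
    calc f * w * m * (f * w) = w * f * m * (f * (star m * C * m)) := by
          rw [← hw, hD.comm hfD hwD]
      _ = w * (f * (m * f * star m)) * C * m := by simp only [mul_assoc]
      _ = w * (m * f * star m) * (d * (e * C)) * m := by
          rw [hD.comm hfD (hm f hfD).1, hf]; simp only [mul_assoc]
      _ = 0 := by rw [heC]; simp only [mul_zero, zero_mul]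

theorem exists_compression_eq_zero {z : A}
    (hz : z ∈ Submodule.span ℂ {m | m ∈ cstarNormalizers D ∧ E m = 0}) {d : A} (hd : d ∈ D)
    (hd0 : d ≠ 0) : ∃ b ∈ D, d * b ≠ 0 ∧ d * b * z * (d * b) = 0 := by
  induction hz using Submodule.span_induction generalizing d with
  | mem m hm => exact hD.exists_compression_eq_zero_of_mem hE hm.1 hm.2 hd hd0
  | zero =>
    refine ⟨star d, star_mem hd, fun h => hd0 (CStarRing.mul_star_self_eq_zero_iff _ |>.1 h), ?_⟩
    simp
  | add y z _ _ hy hz =>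
    obtain ⟨b, hb, hb0, hby⟩ := hy hd hd0
    obtain ⟨c, hc, hc0, hcz⟩ := hz (mul_mem hd hb) hb0
    refine ⟨b * c, mul_mem hb hc, by rwa [← mul_assoc], ?_⟩
    have h1 : d * (b * c) * y * (d * (b * c)) = c * (d * b * y * (d * b)) * c := by
      calc d * (b * c) * y * (d * (b * c)) = d * b * c * y * (d * b * c) := by
            simp only [mul_assoc]
        _ = c * (d * b) * y * (d * b * c) := by rw [hD.comm (mul_mem hd hb) hc]
        _ = _ := by simp only [mul_assoc]
    rw [mul_add, add_mul, h1, hby, mul_zero, zero_mul, zero_add, ← mul_assoc d b c, hcz]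
  | smul c z _ hz =>
    obtain ⟨b, hb, hb0, hbz⟩ := hz hd hd0
    exact ⟨b, hb, hb0, by rw [mul_smul_comm, smul_mul_assoc, hbz, smul_zero]⟩

end IsCartanSubalgebra

end FreeNormalizers

/-! ### Ideals and Cartan subalgebras -/

section Ideals

variable {A : Type*} [NonUnitalCStarAlgebra A] {D : NonUnitalStarSubalgebra ℂ A}

theorem CStarIdeal.mem_of_star_mul_self_mem (J : CStarIdeal A) {a : A}
    (ha : star a * a ∈ J.toSubmodule) : a ∈ J.toSubmodule := by
  rw [← J.quotientMap_eq_zero_iff, ← CStarRing.star_mul_self_eq_zero_iff, ← map_star, ← map_mul]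
  exact J.quotientMap_eq_zero_iff.2 ha

theorem CStarIdeal.mul_mem_annihilatorPerp (J : CStarIdeal A) (c : A) {b : A}
    (hb : b ∈ annihilatorPerp (J.toSubmodule : Set A)) :
    c * b ∈ annihilatorPerp (J.toSubmodule : Set A) := fun x hx => by
  rw [mul_assoc, (hb x hx).1, ← mul_assoc, (hb _ (J.mul_mem_right' c hx)).2, mul_zero]
  exact ⟨rfl, rfl⟩

theorem CStarIdeal.annihilatorPerp_mul_mem (J : CStarIdeal A) (c : A) {b : A}
    (hb : b ∈ annihilatorPerp (J.toSubmodule : Set A)) :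
    b * c ∈ annihilatorPerp (J.toSubmodule : Set A) := fun x hx => by
  rw [mul_assoc, (hb _ (J.mul_mem_left' c hx)).1, ← mul_assoc, (hb x hx).2, zero_mul]
  exact ⟨rfl, rfl⟩

namespace IsCartanSubalgebra

variable (hD : IsCartanSubalgebra D)
include hD

/-- A Cartan subalgebra detects ideals: a closed ideal which meets it trivially is zero. -/
theorem eq_zero_of_mem_ideal (L : CStarIdeal A) (hL : ∀ d ∈ D, d ∈ L.toSubmodule → d = 0) {a : A}
    (ha : a ∈ L.toSubmodule) : a = 0 := by
  obtain ⟨E, hE, hf⟩ := hD.exists_faithful_expectation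
  by_contra ha0
  set z : A := star a * a with hz
  have hzL : z ∈ L.toSubmodule := L.mul_mem_left' _ ha
  have hh : E z ≠ 0 := fun h => ha0 (hf a h)
  have hM : 0 < ‖E z‖ := norm_pos_iff.2 hh
  obtain ⟨d, hd0, hd⟩ : ∃ d : D, d ≠ 0 ∧
      ∀ b : D, ‖E z‖ / 2 * ‖d * b‖ ^ 2 ≤ ‖d * b * E z * (d * b)‖ := by
    let := hD.nonUnitalCommCStarAlgebra
    exact exists_norm_mul_mul_ge hh
  obtain ⟨b, hb, hbz⟩ := Metric.mem_closure_iff.1 (hD.dense_span z) (‖E z‖ / 8) (by positivity)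
  rw [dist_eq_norm] at hbz
  obtain ⟨b', hb', hne, h0⟩ := hD.exists_compression_eq_zero hE
    (hD.sub_expectation_mem_span hE hb) d.2 (fun h => hd0 (Subtype.ext h))
  have hbE : ‖(E z : A) - E b‖ ≤ ‖E z‖ / 8 := by
    have := hE.norm_le (z - b)
    rw [map_sub] at this
    exact this.trans hbz.le
  have hdc := hd ⟨b', hb'⟩
  set c : D := d * ⟨b', hb'⟩ with hc
  have hcA : (c : A) = d * b' := rfl
  rw [← hcA] at h0 hne
  -- The compression of `z ∈ L` by `c` is close to that of `E z`.
  have h1 : (c : A) * E z * c = c * z * c - c * (b - E b) * c - c * (z - b) * c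
      + c * (E z - E b) * c := by
    noncomm_ring
  have h2 : ‖L.quotientMap ((c : A) * E z * c)‖ ≤ ‖E z‖ / 4 * ‖c‖ ^ 2 := by
    have h3 : L.quotientMap ((c : A) * E z * c)
        = L.quotientMap (c * (E z - E b) * c - c * (z - b) * c) := by
      have h4 : L.quotientMap ((c : A) * z * c) = 0 :=
        L.quotientMap_eq_zero_iff.2 (L.mul_mem_right' _ (L.mul_mem_left' _ hzL))
      rw [h1, h0, map_add, map_sub, map_sub, h4, map_sub, map_zero]
      abel
    have hcn (y : A) : ‖(c : A) * y * c‖ ≤ ‖y‖ * ‖c‖ ^ 2 := by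
      calc ‖(c : A) * y * c‖ ≤ ‖(c : A)‖ * ‖y‖ * ‖(c : A)‖ :=
            norm_mul_le_of_le (norm_mul_le _ _) le_rfl
        _ = ‖y‖ * ‖c‖ ^ 2 := by rw [show ‖(c : A)‖ = ‖c‖ from rfl]; ring
    calc ‖L.quotientMap ((c : A) * E z * c)‖
        ≤ ‖(c : A) * (E z - E b) * c - c * (z - b) * c‖ := h3 ▸ L.norm_mkₗ_le _
      _ ≤ ‖(E z : A) - E b‖ * ‖c‖ ^ 2 + ‖z - b‖ * ‖c‖ ^ 2 :=
          (norm_sub_le _ _).trans (add_le_add (hcn _) (hcn _))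
      _ ≤ ‖E z‖ / 8 * ‖c‖ ^ 2 + ‖E z‖ / 8 * ‖c‖ ^ 2 := by gcongr
      _ = _ := by ring
  -- The quotient map is isometric on `D`, as `D ∩ L = 0`.
  have h5 : ‖L.quotientMap ((c : A) * E z * c)‖ = ‖c * E z * c‖ := by
    have : IsClosed (D : Set A) := hD.isClosed
    refine NonUnitalStarAlgHom.norm_map
      (L.quotientMap.comp (NonUnitalStarSubalgebraClass.subtype D)) ?_ (c * E z * c)
    rw [injective_iff_map_eq_zero]
    exact fun y hy => Subtype.ext (hL y y.2 (L.quotientMap_eq_zero_iff.1 hy))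
  have h6 : 0 < ‖c‖ := norm_pos_iff.2 fun h => hne (congrArg Subtype.val h)
  rw [h5] at h2
  have h7 : 0 < ‖E z‖ * ‖c‖ ^ 2 := by positivity
  linarith

variable {J : CStarIdeal A} (hJ : J.IsRegular)
include hJ

/-- A regular ideal `J` is the annihilator of `D ∩ J^⊥`. The set of those `a` with
`a * A * (D ∩ J^⊥) = 0` is an ideal whose intersection with `J^⊥` meets `D` trivially, hence
vanishes; so that set lies in `J^⊥⊥ = J`. It contains the annihilator of `D ∩ J^⊥`, since
conjugation by normalizers preserves `D ∩ J^⊥`. -/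
theorem mem_ideal_iff {a : A} : a ∈ J.toSubmodule ↔
    ∀ h ∈ D, h ∈ annihilatorPerp (J.toSubmodule : Set A) → a * h = 0 := by
  set K : Set A := annihilatorPerp (J.toSubmodule : Set A) with hK
  refine ⟨fun ha h _ hhK => (hhK _ ha).2, fun ha₀ => ?_⟩
  have ha : ∀ h ∈ D, h ∈ K → ∀ y, a * y * h = 0 := fun h hh hhK y => by
    have hy : y ∈ closure (Submodule.span ℂ (cstarNormalizers D) : Set A) := hD.dense_span y
    refine closure_minimal (t := {y | a * y * h = 0}) (fun y
      (hy : y ∈ Submodule.span ℂ (cstarNormalizers D)) => ?_)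
      (isClosed_eq (by fun_prop) continuous_const) hy
    change a * y * h = 0
    induction hy using Submodule.span_induction with
    | mem n hn =>
      have h1 := ha₀ _ (hn _ (mul_mem hh (star_mem hh))).1
        (J.annihilatorPerp_mul_mem (star n)
          (J.mul_mem_annihilatorPerp n (J.annihilatorPerp_mul_mem (star h) hhK)))
      rw [← CStarRing.mul_star_self_eq_zero_iff]
      calc a * n * h * star (a * n * h) = a * (n * (h * star h) * star n) * star a := by
            simp only [star_mul, mul_assoc]
        _ = 0 := by rw [h1, zero_mul]
    | zero => simp
    | add y z _ _ hy hz => rw [mul_add, add_mul, hy, hz, add_zero]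
    | smul c y _ hy => rw [mul_smul_comm, smul_mul_assoc, hy, smul_zero]
  let L : CStarIdeal A :=
    { carrier := {b | b ∈ K ∧ ∀ h ∈ D, h ∈ K → ∀ y, b * y * h = 0}
      add_mem' := fun {b c} hb hc => ⟨fun x hx => by
        rw [add_mul, mul_add, (hb.1 x hx).1, (hb.1 x hx).2, (hc.1 x hx).1, (hc.1 x hx).2]
        simp, fun h hh hhK y => by
        rw [add_mul, add_mul, hb.2 h hh hhK, hc.2 h hh hhK, add_zero]⟩
      zero_mem' := ⟨fun x hx => by simp, fun h hh hhK y => by simp⟩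
      smul_mem' := fun r b hb => ⟨fun x hx => by
        rw [smul_mul_assoc, mul_smul_comm, (hb.1 x hx).1, (hb.1 x hx).2]; simp,
        fun h hh hhK y => by
        rw [smul_mul_assoc, smul_mul_assoc, hb.2 h hh hhK, smul_zero]⟩
      mul_mem_left' := fun c {b} hb => ⟨J.mul_mem_annihilatorPerp c hb.1, fun h hh hhK y => by
        rw [mul_assoc, mul_assoc, ← mul_assoc b, hb.2 h hh hhK, mul_zero]⟩
      mul_mem_right' := fun c {b} hb => ⟨J.annihilatorPerp_mul_mem c hb.1, fun h hh hhK y => by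
        rw [mul_assoc b, hb.2 h hh hhK]⟩
      isClosed' := by
        simp only [hK, annihilatorPerp, Set.ofPred_and, Set.ofPred_forall]
        refine .inter (isClosed_iInter fun x => isClosed_iInter fun _ => .inter ?_ ?_)
          (isClosed_iInter fun h => isClosed_iInter fun _ => isClosed_iInter fun _ =>
            isClosed_iInter fun y => ?_)
        all_goals exact isClosed_eq (by fun_prop) continuous_const }
  have hL : ∀ b ∈ L.toSubmodule, b = 0 := by
    refine fun b hb => hD.eq_zero_of_mem_ideal L (fun d hd hdL => ?_) hb
    have h1 : d * star d * d = 0 := hdL.2 d hd hdL.1 (star d)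
    rw [← CStarRing.star_mul_self_eq_zero_iff d, ← CStarRing.star_mul_self_eq_zero_iff]
    calc star (star d * d) * (star d * d) = star d * (d * star d * d) := by
          simp only [star_mul, star_star, mul_assoc]
      _ = 0 := by rw [h1, mul_zero]
  have hJ' : a ∈ (J.toSubmodule : Set A) := by
    rw [hJ]
    refine fun k hk => ⟨hL _ ⟨J.mul_mem_annihilatorPerp a hk, fun h hh hhK y => ?_⟩,
      hL _ ⟨J.annihilatorPerp_mul_mem a hk, fun h hh hhK y => ?_⟩⟩
    · rw [mul_assoc a, ha h hh hhK]
    · rw [mul_assoc, mul_assoc, ← mul_assoc a, ha h hh hhK, mul_zero]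
  exact hJ'

variable {E : A →ₗ[ℂ] D} (hE : IsConditionalExpectation D E)
include hE

/-- A regular ideal is invariant under the expectation, which therefore passes to the quotient. -/
theorem expectation_mem_ideal {a : A} (ha : a ∈ J.toSubmodule) : (E a : A) ∈ J.toSubmodule := by
  refine (hD.mem_ideal_iff hJ).2 fun h hh hhK => ?_
  rw [← hE.mul_right a hh, (hD.mem_ideal_iff hJ).1 ha h hh hhK]
  simp

/-- The expectation induced on the quotient by a regular ideal is faithful. -/
theorem mem_ideal_of_expectation_mem (hf : ∀ a : A, E (star a * a) = 0 → a = 0) {a : A}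
    (ha : (E (star a * a) : A) ∈ J.toSubmodule) : a ∈ J.toSubmodule := by
  refine (hD.mem_ideal_iff hJ).2 fun h hh hhK => hf _ (Subtype.ext ?_)
  have h1 : star (a * h) * (a * h) = star h * (star a * a * h) := by
    simp only [star_mul, mul_assoc]
  rw [h1, hE.mul_left (star_mem hh), hE.mul_right _ hh, (hD.mem_ideal_iff hJ).1 ha h hh hhK,
    mul_zero]
  rfl

/-- In the quotient by a regular ideal `J`, an element which commutes with the image of `D` and has
expectation zero vanishes. If `m` is a normalizer with `E m = 0` and `r = E (m⋆ a)`, then for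
`k ∈ D ∩ J^⊥` the element `m r k` commutes with `D` in `A` itself, because multiplication by `k`
turns congruences modulo `J` into equalities; so `m r k = E (m) r k = 0`, whence `r ∈ J`. -/
theorem mem_ideal_of_comm (hf : ∀ a : A, E (star a * a) = 0 → a = 0) {a : A}
    (hc : ∀ d ∈ D, d * a - a * d ∈ J.toSubmodule) (ha : (E a : A) ∈ J.toSubmodule) :
    a ∈ J.toSubmodule := by
  -- Normalizers are treated first when their expectation is zero; the others reduce to these.
  have hfree : ∀ m ∈ cstarNormalizers D, E m = 0 → (E (star m * a) : A) ∈ J.toSubmodule := by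
    intro m hm hm0
    set r : A := ↑(E (star m * a)) with hr
    have hrD : r ∈ D := (E _).2
    have hp := hD.star_mul_self_mem hm
    have hq := hD.mul_star_self_mem hm
    -- Modulo `J`, the normalizer `m` implements the identity of `D` on the support of `r`.
    have h1 : ∀ d ∈ D, star m * d * m * r - star m * m * d * r ∈ J.toSubmodule := by
      intro d hd
      have h2 : (E (star m * m * star m * (d * a - a * d)) : A) ∈ J.toSubmodule :=
        hD.expectation_mem_ideal hJ hE (J.mul_mem_left' _ (hc d hd))
      have h3 : star m * m * star m * (d * a - a * d)
          = star m * d * m * (star m * a) - star m * m * (star m * a * d) := by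
        have h4 : star m * d * m * (star m * a) = star m * (m * star m * d) * a := by
          rw [← hD.comm hd hq]; simp only [mul_assoc]
        rw [h4]
        noncomm_ring
      rw [h3, map_sub, AddSubgroupClass.coe_sub, hE.mul_left (hm d hd).2, hE.mul_left hp,
        hE.mul_right _ hd, ← hr, hD.comm hrD hd, ← mul_assoc (star m * m)] at h2
      exact h2
    have h5 : star m * m * r ∈ J.toSubmodule := by
      refine (hD.mem_ideal_iff hJ).2 fun k hk hkK => ?_
      -- `m * (r * k)` commutes with `D`, so it equals its expectation, which is zero.
      have h6 : star (m * (r * k)) ∈ D := by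
        have hrk := mul_mem hrD hk
        refine hD.mem_of_forall_mul_mul_star_eq (star_mem_cstarNormalizers
          (mul_mem_cstarNormalizers hm (mem_cstarNormalizers_of_mem hrk))) fun d hd => ?_
        have h7 := (hD.mem_ideal_iff hJ).1 (h1 d hd) k hk hkK
        rw [sub_mul, sub_eq_zero] at h7
        calc star (m * (r * k)) * d * star (star (m * (r * k)))
            = star (r * k) * (star m * d * m * r * k) := by
              simp only [star_mul, star_star, mul_assoc]
          _ = star (r * k) * (star m * m) * d * (r * k) := by
              rw [h7]; simp only [mul_assoc]
          _ = d * (star (r * k) * (star m * m)) * (r * k) := by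
              rw [hD.comm (mul_mem (star_mem hrk) hp) hd]
          _ = _ := by simp only [star_mul, star_star, mul_assoc]
      have h8 : m * (r * k) ∈ D := by simpa using star_mem h6
      have h9 : m * (r * k) = 0 := by
        rw [← hE.map_of_mem h8, hE.mul_right _ (mul_mem hrD hk), hm0]
        simp
      calc star m * m * r * k = star m * (m * (r * k)) := by simp only [mul_assoc]
        _ = 0 := by rw [h9, mul_zero]
    have h10 : m * r ∈ J.toSubmodule := by
      refine J.mem_of_star_mul_self_mem ?_
      have h11 : star (m * r) * (m * r) = star r * (star m * m * r) := by
        simp only [star_mul, mul_assoc]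
      rw [h11]
      exact J.mul_mem_left' _ h5
    refine J.mem_of_star_mul_self_mem ?_
    have h12 := hD.expectation_mem_ideal hJ hE (J.mul_mem_right' a (J.star_mem h10))
    rwa [star_mul, mul_assoc, hE.mul_left (star_mem hrD), ← hr] at h12
  have hall : ∀ b, (E (star b * a) : A) ∈ J.toSubmodule := by
    intro b
    have hb : b ∈ closure (Submodule.span ℂ (cstarNormalizers D) : Set A) := hD.dense_span b
    refine closure_minimal (t := {b | (E (star b * a) : A) ∈ J.toSubmodule}) (fun b
      (hb : b ∈ Submodule.span ℂ (cstarNormalizers D)) => ?_)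
      (J.isClosed'.preimage (hE.continuous.comp (by fun_prop))) hb
    change (E (star b * a) : A) ∈ J.toSubmodule
    induction hb using Submodule.span_induction with
    | mem n hn =>
      have h1 : star n * a = star (n - E n) * a + star (E n : A) * a := by
        rw [← add_mul, ← star_add, sub_add_cancel]
      rw [h1, map_add]
      refine add_mem (hfree _ (hD.sub_expectation_mem hE hn) (hE.map_sub_map n)) ?_
      rw [hE.mul_left (star_mem (E n).2)]
      exact J.mul_mem_left' _ ha
    | zero => simp
    | add y z _ _ hy hz =>
      rw [star_add, add_mul, map_add]
      exact add_mem hy hz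
    | smul c y _ hy =>
      rw [star_smul, smul_mul_assoc, map_smul]
      exact J.toSubmodule.smul_mem _ hy
  exact hD.mem_ideal_of_expectation_mem hJ hE hf (hall a)

end IsCartanSubalgebra

end Ideals

/-! ### The quotient -/

theorem mainTheorem3 {A : Type*} [NonUnitalCStarAlgebra A]
    (D : NonUnitalStarSubalgebra ℂ A) (hD : IsCartanSubalgebra D)
    (J : CStarIdeal A) (hJ : J.IsRegular) :
    IsCartanSubalgebra (D.map J.quotientMap) := by
  obtain ⟨E, hE, hf⟩ := hD.exists_faithful_expectation
  set π := J.quotientMap with hπ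
  have hmem {d : A} (hd : d ∈ D) : π d ∈ D.map π := ⟨d, hd, rfl⟩
  have hπc : Continuous π :=
    (LinearMap.mkContinuous J.mkₗ 1 fun a => by rw [one_mul]; exact J.norm_mkₗ_le a).continuous
  have hEJ (a : A) (ha : a ∈ J.toSubmodule) : (E a : A) ∈ J.toSubmodule :=
    hD.expectation_mem_ideal hJ hE ha
  -- The expectation induced on the quotient.
  let E₀ : A →ₗ[ℂ] D.map π :=
    { toFun := fun a => ⟨π (E a), hmem (E a).2⟩
      map_add' := fun a b => Subtype.ext (by simp)
      map_smul' := fun c a => Subtype.ext (by simp) }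
  let F : J.Quotient →ₗ[ℂ] D.map π := J.toSubmodule.liftQ E₀ fun a ha =>
    Subtype.ext (J.quotientMap_eq_zero_iff.2 (hEJ a ha))
  have hF (a : A) : (F (π a) : J.Quotient) = π (E a) := rfl
  have hFn (x : J.Quotient) : ‖F x‖ ≤ ‖x‖ := by
    refine le_of_forall_pos_le_add fun ε hε => ?_
    obtain ⟨a, rfl, ha⟩ := J.exists_norm_lt x hε
    exact (J.norm_mkₗ_le (E a : A)).trans ((hE.norm_le a).trans ha.le)
  have hFc : Continuous fun x => (F x : J.Quotient) := continuous_subtype_val.comp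
    (F.mkContinuous 1 fun x => by rw [one_mul]; exact hFn x).continuous
  have hFcoe (b : D.map π) : F (b : J.Quotient) = b := by
    obtain ⟨_, d, hd, rfl⟩ := b
    refine Subtype.ext ?_
    change π (E d) = π d
    rw [hE.map_of_mem hd]
  have hFE : IsConditionalExpectation (D.map π) F :=
    { map_coe := hFcoe
      map_mul_left := by
        rintro ⟨_, d, hd, rfl⟩ x
        obtain ⟨a, rfl⟩ := J.quotientMap_surjective x
        refine Subtype.ext ?_
        change (F (π d * π a) : J.Quotient) = π d * F (π a)
        rw [← map_mul, hF, hF, hE.mul_left hd, map_mul]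
      map_mul_right := by
        rintro x ⟨_, d, hd, rfl⟩
        obtain ⟨a, rfl⟩ := J.quotientMap_surjective x
        refine Subtype.ext ?_
        change (F (π a * π d) : J.Quotient) = F (π a) * π d
        rw [← map_mul, hF, hF, hE.mul_right a hd, map_mul]
      map_nonneg := by
        intro x
        obtain ⟨a, rfl⟩ := J.quotientMap_surjective x
        obtain ⟨b, hb⟩ := hE.map_nonneg a
        refine ⟨⟨π b, hmem b.2⟩, Subtype.ext ?_⟩
        change (F (star (π a) * π a) : J.Quotient) = star (π b) * π b
        rw [← map_star, ← map_mul, hF, hb, ← map_star, ← map_mul]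
        rfl
      norm_le := hFn }
  refine
    { isClosed := ?_
      exists_approximateUnit := ?_
      dense_span := ?_
      exists_faithful_expectation := ⟨F, hFE, ?_⟩
      isMaximalAbelian := ⟨?_, ?_⟩ }
  · -- The image of `D` is the fixed point set of the continuous map `F`.
    have h : (D.map π : Set J.Quotient) = {x | (F x : J.Quotient) = x} := by
      ext x
      exact ⟨fun hx => congrArg Subtype.val (hFcoe ⟨x, hx⟩), fun hx => by
        rw [← show (F x : J.Quotient) = x from hx]; exact (F x).2⟩
    rw [h]
    exact isClosed_eq hFc continuous_id
  · obtain ⟨l, hl, hlD⟩ := hD.exists_approximateUnit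
    have := hl.neBot
    refine ⟨l.map π, ⟨fun x => ?_, fun x => ?_⟩, ?_⟩
    · obtain ⟨a, rfl⟩ := J.quotientMap_surjective x
      rw [tendsto_map'_iff]
      exact ((hπc.tendsto a).comp (hl.tendsto_mul_left a)).congr fun u => map_mul π a u
    · obtain ⟨a, rfl⟩ := J.quotientMap_surjective x
      rw [tendsto_map'_iff]
      exact ((hπc.tendsto a).comp (hl.tendsto_mul_right a)).congr fun u => map_mul π u a
    · rw [eventually_map]
      refine hlD.mono fun u ⟨hu, hu1, b, hb, hub⟩ =>
        ⟨hmem hu, (J.norm_mkₗ_le u).trans hu1, π b, hmem hb, ?_⟩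
      rw [hub, map_mul, map_star]
  · have h1 := J.quotientMap_surjective.denseRange.dense_image hπc hD.dense_span
    refine h1.mono ?_
    rintro _ ⟨b, hb, rfl⟩
    have h2 : Submodule.span ℂ (cstarNormalizers D) ≤
        (Submodule.span ℂ (cstarNormalizers (D.map π))).comap J.mkₗ := by
      refine Submodule.span_le.2 fun n hn => Submodule.subset_span ?_
      rintro _ ⟨d, hd, rfl⟩
      change π n * π d * star (π n) ∈ D.map π ∧ star (π n) * π d * π n ∈ D.map π
      rw [← map_star, ← map_mul, ← map_mul, ← map_mul, ← map_mul]
      exact ⟨hmem (hn d hd).1, hmem (hn d hd).2⟩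
    exact h2 hb
  · intro x hx
    obtain ⟨a, rfl⟩ := J.quotientMap_surjective x
    refine J.quotientMap_eq_zero_iff.2 (hD.mem_ideal_of_expectation_mem hJ hE hf ?_)
    rw [← J.quotientMap_eq_zero_iff, ← hπ, ← hF, map_mul, map_star, hx]
    rfl
  · rintro _ ⟨c, hc, rfl⟩ _ ⟨d, hd, rfl⟩
    exact (map_mul π c d).symm.trans ((congrArg π (hD.comm hc hd)).trans (map_mul π d c))
  · intro C hC hDC x hx
    obtain ⟨a, rfl⟩ := J.quotientMap_surjective x
    have h1 : a - E a ∈ J.toSubmodule := by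
      refine hD.mem_ideal_of_comm hJ hE hf (fun d hd => ?_) (by simp [hE.map_sub_map])
      have h2 : d * (a - E a) - (a - E a) * d = d * a - a * d := by
        rw [mul_sub, sub_mul, hD.comm hd (E a).2]
        abel
      rw [h2, ← J.quotientMap_eq_zero_iff, map_sub, map_mul, map_mul, sub_eq_zero]
      exact hC _ (hDC (hmem hd)) _ hx
    have h2 : π a = π (E a) := J.mkₗ_eq_iff.2 h1
    rw [h2]
    exact hmem (E a).2
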